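/- Let $R$ be a (not necessarily commutative) ring with identity that is coherent, i.e. every finitely generated left ideal is finitely presented as a left $R$-module and every finitely generated right ideal is finitely presented as a right $R$-module. "Module" means left $R$-module. A module $A$ is called absolutely pure (FP-injective) if $\operatorname{Ext}^1_R(F,A)=0$ for every finitely presented module $F$. A module $M$ is called a transfinite extension of finitely presented modules if there are an ordinal $\lambda$ and an increasing chain $(M_\alpha)_{\alpha\le\lambda}$ of submodules of $M$ such that $M_0=0$, $M_\lambda=M$, $M_\beta=\bigcup_{\alpha<\beta}M_\alpha$ for every limit ordinal $\beta\le\lambda$, and $M_{\alpha+1}/M_\alpha$ is finitely presented for every $\alpha<\lambda$. Let $P=(\cdots\to P_{n+1}\xrightarrow{d_{n+1}}P_n\xrightarrow{d_n}P_{n-1}\to\cdots)$, $n\in\mathbb{Z}$, be an exact chain complex of projective modules, and let $Z_nP=\ker d_n$. Then $\operatorname{Ext}^1_R(Z_nP,A)=0$ for every $n\in\mathbb{Z}$ and every absolutely pure module $A$. Consequently, for every $n\in\mathbb{Z}$, the module $Z_nP$ is a retract (direct summand) of a transfinite extension of finitely presented modules. -/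

import Mathlib

open CategoryTheory

universe u

/-- A ring is coherent if it is both left and right coherent: every finitely generated left ideal is
finitely presented as a left module, and every finitely generated right ideal is finitely presented
as a right module. Right ideals are the submodules of `R` as a module over `Rᵐᵒᵖ`. -/
structure IsCoherentRing (R : Type u) [Ring R] : Prop where
  left : ∀ I : Submodule R R, I.FG → Module.FinitePresentation R I
  right : ∀ I : Submodule Rᵐᵒᵖ R, I.FG → Module.FinitePresentation Rᵐᵒᵖ I

/-- The class of finitely presented left `R`-modules. -/
def finitelyPresentedModules (R : Type u) [Ring R] : ObjectProperty (ModuleCat.{u} R) :=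
  fun M => Module.FinitePresentation R M

/-- Absolutely pure (FP-injective) modules: `Ext¹(F, A) = 0` for all finitely presented `F`. -/
def IsAbsolutelyPure {R : Type u} [Ring R] (A : ModuleCat.{u} R) : Prop :=
  ∀ F : ModuleCat.{u} R, finitelyPresentedModules R F → Subsingleton (Abelian.Ext.{u} F A 1)

/-- `M` is a transfinite extension of modules in the class `S`: it is the union of a well-ordered
continuous increasing chain of submodules `N α`, `α ≤ o`, which starts at `0` and whose successive
quotients `N (α + 1) / N α` belong to `S`. -/
def IsTransfiniteExtension {R : Type u} [Ring R] (S : ObjectProperty (ModuleCat.{u} R))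
    (M : ModuleCat.{u} R) : Prop :=
  ∃ (o : Ordinal.{u}) (N : Ordinal.{u} → Submodule R M),
    Monotone N ∧ N 0 = ⊥ ∧ N o = ⊤ ∧
    (∀ l ≤ o, Order.IsSuccLimit l → N l = ⨆ a : Set.Iio l, N a) ∧
    ∀ a < o, S (ModuleCat.of R (N (Order.succ a) ⧸ (N a).submoduleOf (N (Order.succ a))))

/-!
Only left coherence matters, and it enters through one fact: a finitely generated submodule of a
free left module is finitely presented (`finitePresentation_of_fg_submodule_finsupp`).

The complex is replaced by the total module `M = ⨁ n, P.X n` with its total differential `d`. Then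
`M` is projective, `ker d = range d`, and each `P.cycles n` is a retract of `ker d`
(`ChainComplex.cyclesRetractKerTotalDifferential`), so it suffices to show that `ker d` is a
transfinite extension of finitely presented modules (`isTransfiniteExtension_ker`) and that
`Ext¹(-, A)` vanishes on such extensions when it vanishes on their factors (Eklof's lemma,
`IsTransfiniteExtension.subsingleton_ext`).

For the first point write `M` as a retract of a free module, `π : (B →₀ R) → M` with section `s`.
A subset `S` of the basis is an exact support (`IsExactSupport`) if `s ∘ d ∘ π` preserves the
submodule spanned by `S` and every cycle in the image of that submodule is the boundary of an
element of that image. By coherence, when `S` is an exact support and `X` is finite, finitely many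
basis elements added to `S ∪ X` bound all the cycles coming from `S ∪ X`
(`IsExactSupport.exists_finset`); after `ω` such steps an exact support is reached again. The
boundaries supported on `S ∪ X`, modulo those supported on `S`, form a finitely generated submodule
of the free module on the complement of `S`, hence all factors along these `ω` steps are finitely
presented (`IsExactSupport.finitePresentation_quotient`). Iterating transfinitely and reading off
the stages `ω * α + k` gives the required chain (`exists_ordinal_chain`).
-/

/-! ### Finitely generated submodules of free modules over a coherent ring -/

theorem LinearMap.map_subtype_ker_submoduleMap {R M F : Type*} [Ring R] [AddCommGroup M]
    [Module R M] [AddCommGroup F] [Module R F] (f : M →ₗ[R] F) (N : Submodule R M) :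
    (LinearMap.ker (f.submoduleMap N)).map N.subtype = N ⊓ LinearMap.ker f := by
  ext x
  constructor
  · rintro ⟨y, hy, rfl⟩
    exact ⟨y.2, congrArg Subtype.val (LinearMap.mem_ker.1 hy)⟩
  · rintro ⟨hx, hx0⟩
    exact ⟨⟨x, hx⟩, LinearMap.mem_ker.2 (Subtype.ext hx0), rfl⟩

theorem Submodule.fg_inf_ker_of_finitePresentation_map {R M F : Type*} [Ring R] [AddCommGroup M]
    [Module R M] [AddCommGroup F] [Module R F] (f : M →ₗ[R] F) (N : Submodule R M) (hN : N.FG)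
    (hmap : Module.FinitePresentation R (N.map f)) : (N ⊓ LinearMap.ker f).FG := by
  let g : N →ₗ[R] N.map f := f.submoduleMap N
  have := Module.Finite.iff_fg.2 hN
  have hk : (LinearMap.ker g).FG :=
    Module.FinitePresentation.fg_ker g (f.submoduleMap_surjective N)
  rw [← LinearMap.map_subtype_ker_submoduleMap f N]
  exact hk.map N.subtype

theorem finitePresentation_of_map_of_inf_ker {R M F : Type*} [Ring R] [AddCommGroup M] [Module R M]
    [AddCommGroup F] [Module R F] (f : M →ₗ[R] F) (N : Submodule R M)
    (hmap : Module.FinitePresentation R (N.map f))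
    (hker : Module.FinitePresentation R (N ⊓ LinearMap.ker f : Submodule R M)) :
    Module.FinitePresentation R N := by
  let g : N →ₗ[R] N.map f := f.submoduleMap N
  rw [← LinearMap.map_subtype_ker_submoduleMap f N] at hker
  have : Module.FinitePresentation R (LinearMap.ker g) :=
    Module.FinitePresentation.of_equiv
      ((LinearMap.ker g).equivMapOfInjective N.subtype N.injective_subtype).symm
  exact Module.finitePresentation_of_ker g (f.submoduleMap_surjective N)

/-- Induction on the number of coordinates: the last coordinate maps a finitely generated `N` onto a
finitely generated left ideal, which is finitely presented, so the kernel is again finitely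
generated, and it involves one coordinate fewer. -/
theorem finitePresentation_of_fg_of_le_supported {R : Type*} [Ring R] {ι : Type*}
    (hR : ∀ I : Submodule R R, I.FG → Module.FinitePresentation R I) (s : Finset ι) :
    ∀ N : Submodule R (ι →₀ R), N ≤ Finsupp.supported R R (s : Set ι) → N.FG →
      Module.FinitePresentation R N := by
  classical
  induction s using Finset.induction_on with
  | empty =>
    intro N hN _
    obtain rfl : N = ⊥ := by simpa using hN
    exact Module.finitePresentation_of_projective (R := R) (M := (⊥ : Submodule R (ι →₀ R)))
  | insert a s ha ih =>
    intro N hN hfg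
    have hmap := hR _ (hfg.map (Finsupp.lapply a))
    refine finitePresentation_of_map_of_inf_ker (Finsupp.lapply a) N hmap
      (ih _ ?_ (Submodule.fg_inf_ker_of_finitePresentation_map _ N hfg hmap))
    rintro x ⟨hx, hxa⟩
    have hxs := hN hx
    rw [Finsupp.mem_supported] at hxs ⊢
    intro i hi
    have := hxs hi
    rw [Finset.coe_insert] at this
    rcases this with rfl | h
    · exact absurd hxa (by simpa using hi)
    · exact h

/-- Over a left coherent ring, finitely generated submodules of free modules are finitely presented. -/
theorem finitePresentation_of_fg_submodule_finsupp {R : Type*} [Ring R] {ι : Type*}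
    (hR : ∀ I : Submodule R R, I.FG → Module.FinitePresentation R I)
    (N : Submodule R (ι →₀ R)) (hN : N.FG) : Module.FinitePresentation R N := by
  classical
  obtain ⟨t, rfl⟩ := hN
  refine finitePresentation_of_fg_of_le_supported hR (t.biUnion Finsupp.support) _ ?_ ⟨t, rfl⟩
  rw [Submodule.span_le]
  intro x hx
  rw [SetLike.mem_coe, Finsupp.mem_supported]
  exact_mod_cast Finset.subset_biUnion_of_mem Finsupp.support hx

/-- Suppose all finitely generated submodules of the target of `h` are finitely presented, and `V`
contains the kernel of `h` on `W`. If `h(V)` and `h(W)` are finitely generated, then `W / V` is the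
quotient of a finitely presented module by a finitely generated one, hence finitely presented. -/
theorem finitePresentation_quotient_of_fg_map {R M F : Type*} [Ring R]
    [AddCommGroup M] [Module R M] [AddCommGroup F] [Module R F]
    (hF : ∀ N : Submodule R F, N.FG → Module.FinitePresentation R N)
    {V W : Submodule R M} (h : M →ₗ[R] F) (hVW : V ≤ W)
    (hker : ∀ w ∈ W, h w = 0 → w ∈ V) (hV : (V.map h).FG) (hW : (W.map h).FG) :
    Module.FinitePresentation R (W ⧸ V.submoduleOf W) := by
  have := hF _ hW
  have hsurj := h.submoduleMap_surjective W
  set g : W →ₗ[R] W.map h := h.submoduleMap W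
  have hle : LinearMap.ker g ≤ LinearMap.ker (V.submoduleOf W).mkQ := by
    intro w hw
    rw [Submodule.ker_mkQ]
    exact hker w w.2 (congrArg Subtype.val (LinearMap.mem_ker.1 hw))
  let e := g.quotKerEquivOfSurjective hsurj
  let l : W.map h →ₗ[R] W ⧸ V.submoduleOf W := (LinearMap.ker g).liftQ _ hle ∘ₗ e.symm.toLinearMap
  have hl : ∀ w : W, l (g w) = (V.submoduleOf W).mkQ w := by
    intro w
    have : e.symm (g w) = Submodule.Quotient.mk w := by
      rw [LinearEquiv.symm_apply_eq]; rfl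
    simp [l, this]
  refine Module.finitePresentation_of_surjective l ?_ ?_
  · intro q
    obtain ⟨w, rfl⟩ := Submodule.mkQ_surjective _ q
    exact ⟨g w, hl w⟩
  · have hk : (LinearMap.ker l).map (W.map h).subtype = V.map h := by
      ext y
      constructor
      · rintro ⟨x, hx, rfl⟩
        obtain ⟨w, rfl⟩ := hsurj x
        have hx : l (g w) = 0 := hx
        rw [hl, Submodule.mkQ_apply, Submodule.Quotient.mk_eq_zero] at hx
        exact ⟨w, hx, rfl⟩
      · rintro ⟨v, hv, rfl⟩
        refine ⟨g ⟨v, hVW hv⟩, ?_, rfl⟩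
        change l _ = 0
        rw [hl, Submodule.mkQ_apply, Submodule.Quotient.mk_eq_zero]
        exact hv
    exact Submodule.fg_of_fg_map_injective _ (W.map h).injective_subtype (hk ▸ hV)

/-! ### Ordinal chains refined by sequences -/

/-- If every `good` element of a complete lattice extends, through an increasing sequence of
`step`s, to a strictly larger `good` element (unless it is `⊤`), and suprema of chains of `good`
elements are `good`, then `⊥` and `⊤` are joined by a continuous ordinal chain of `step`s. Its
member at `ω * α + k` is the `k`-th term of the sequence that starts at the `α`-th good element. -/
theorem exists_ordinal_chain {I : Type u} [CompleteLattice I] (good : I → Prop)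
    (step : I → I → Prop) (hbot : good ⊥)
    (hsup : ∀ c : Set I, c.Nonempty → IsChain (· ≤ ·) c → (∀ S ∈ c, good S) → good (sSup c))
    (hstep : ∀ S, good S → ∃ T : ℕ → I, T 0 = S ∧ Monotone T ∧ good (⨆ k, T k) ∧
      (S ≠ ⊤ → S < ⨆ k, T k) ∧ ∀ k, step (T k) (T (k + 1))) :
    ∃ (o : Ordinal.{u}) (T : Ordinal.{u} → I), Monotone T ∧ T 0 = ⊥ ∧ T o = ⊤ ∧
      (∀ l, Order.IsSuccLimit l → T l = ⨆ a : Set.Iio l, T a) ∧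
      ∀ a, step (T a) (T (Order.succ a)) := by
  classical
  choose! t ht0 htm htg htlt hts using hstep
  -- off the good elements the iteration is made to jump to `⊤`
  let φ : I → I := fun S => if good S then ⨆ k, t S k else ⊤
  have hφg : ∀ S, good S → φ S = ⨆ k, t S k := fun S hS => if_pos hS
  have hle : ∀ S, S ≤ φ S := by
    intro S
    by_cases hS : good S
    · rw [hφg S hS]
      exact (ht0 S hS).ge.trans (le_iSup (t S) 0)
    · simp [φ, hS]
  have hφlt : ∀ S, S ≠ ⊤ → S < φ S := by
    intro S hS
    by_cases h : good S
    · rw [hφg S h]; exact htlt S h hS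
    · simpa [φ, h] using hS.lt_top
  let F : Ordinal.{u} → I := fun a => transfiniteIterate φ a ⊥
  have hF0 : F 0 = ⊥ := transfiniteIterate_bot φ ⊥
  have hFs : ∀ a, F (Order.succ a) = φ (F a) := fun a => transfiniteIterate_succ φ ⊥ a (not_isMax a)
  have hFl : ∀ a, Order.IsSuccLimit a → F a = ⨆ x : Set.Iio a, F x :=
    fun a ha => transfiniteIterate_limit φ ⊥ a ha
  have hFm : Monotone F := monotone_transfiniteIterate φ ⊥ hle
  have hFg : ∀ a, good (F a) := by
    intro a
    induction a using Ordinal.limitRecOn with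
    | zero => rwa [hF0]
    | add_one a ih => rw [← Order.succ_eq_add_one, hFs, hφg _ ih]; exact htg _ ih
    | limit a ha ih =>
      rw [hFl a ha, ← sSup_range]
      have : Nonempty (Set.Iio a) := ⟨⟨0, ha.bot_lt⟩⟩
      refine hsup _ (Set.range_nonempty _) ?_ ?_
      · exact (hFm.comp (Subtype.mono_coe (· ∈ Set.Iio a))).isChain_range
      · rintro _ ⟨x, rfl⟩
        exact ih x x.2
  obtain ⟨j, hj⟩ : ∃ j, F j = ⊤ :=
    top_mem_range_transfiniteIterate φ ⊥ hφlt (top_le_iff.1 (hle ⊤))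
      (not_injective_of_ordinal F)
  -- `m a` is the finite part of `a = ω * (a / ω) + m a`
  have hω : Ordinal.omega0 ≠ 0 := Ordinal.omega0_ne_zero
  have hmod : ∀ a : Ordinal.{u}, ∃ n : ℕ, a % Ordinal.omega0 = n := fun a =>
    Ordinal.lt_omega0.1 (Ordinal.mod_lt a hω)
  choose m hm using hmod
  have hdecomp : ∀ a : Ordinal.{u}, Ordinal.omega0 * (a / Ordinal.omega0) + m a = a := by
    intro a
    rw [← hm, Ordinal.div_add_mod]
  have hdiv : ∀ (q : Ordinal.{u}) (n : ℕ), (Ordinal.omega0 * q + n) / Ordinal.omega0 = q := by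
    intro q n
    rw [Ordinal.mul_add_div _ hω, Ordinal.div_eq_zero_of_lt (Ordinal.natCast_lt_omega0 n), add_zero]
  have hmd : ∀ (q : Ordinal.{u}) (n : ℕ), m (Ordinal.omega0 * q + n) = n := by
    intro q n
    have h := hm (Ordinal.omega0 * q + n)
    rw [Ordinal.mul_add_mod_self, Ordinal.mod_eq_of_lt (Ordinal.natCast_lt_omega0 n)] at h
    exact_mod_cast h.symm
  let T : Ordinal.{u} → I := fun a => t (F (a / Ordinal.omega0)) (m a)
  have hT : ∀ (q : Ordinal.{u}) (n : ℕ), T (Ordinal.omega0 * q + n) = t (F q) n := by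
    intro q n
    simp only [T, hdiv, hmd]
  have hTω : ∀ q : Ordinal.{u}, T (Ordinal.omega0 * q) = F q := by
    intro q
    have := hT q 0
    rwa [Nat.cast_zero, add_zero, ht0 _ (hFg q)] at this
  have hTm : Monotone T := by
    intro a b hab
    rcases (Ordinal.div_le_left hab Ordinal.omega0).lt_or_eq with h | h
    · calc T a ≤ F (Order.succ (a / Ordinal.omega0)) := by
            rw [hFs, hφg _ (hFg _)]; exact le_iSup (t (F (a / Ordinal.omega0))) (m a)
        _ ≤ F (b / Ordinal.omega0) := hFm (Order.succ_le_of_lt h)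
        _ = t (F (b / Ordinal.omega0)) 0 := (ht0 _ (hFg _)).symm
        _ ≤ T b := htm _ (hFg _) (Nat.zero_le _)
    · have hmn : m a ≤ m b := by
        have h2 := hab
        rw [← hdecomp a, ← hdecomp b, h, add_le_add_iff_left] at h2
        exact_mod_cast h2
      change t (F (a / Ordinal.omega0)) (m a) ≤ t (F (b / Ordinal.omega0)) (m b)
      rw [h]
      exact htm _ (hFg _) hmn
  refine ⟨Ordinal.omega0 * j, T, hTm, ?_, ?_, ?_, ?_⟩
  · have := hTω 0
    rwa [mul_zero, hF0] at this
  · rw [hTω, hj]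
  · intro l hl
    refine le_antisymm ?_ (iSup_le fun a => hTm (le_of_lt a.2))
    obtain ⟨q, rfl⟩ := Ordinal.isSuccPrelimit_iff_omega0_dvd.1 hl.isSuccPrelimit
    rw [hTω]
    rcases Ordinal.zero_or_succ_or_isSuccLimit q with rfl | ⟨p, rfl⟩ | hq
    · simp at hl
    · rw [hFs, hφg _ (hFg _)]
      refine iSup_le fun k => ?_
      rw [← hT]
      refine le_iSup_of_le ⟨Ordinal.omega0 * p + k, ?_⟩ le_rfl
      rw [Set.mem_Iio, Ordinal.mul_succ, add_lt_add_iff_left]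
      exact Ordinal.natCast_lt_omega0 k
    · rw [hFl q hq]
      refine iSup_le fun x => ?_
      rw [← hTω]
      refine le_iSup_of_le ⟨Ordinal.omega0 * x, ?_⟩ le_rfl
      exact mul_lt_mul_of_pos_left x.2 Ordinal.omega0_pos
  · intro a
    have h := hts (F (a / Ordinal.omega0)) (hFg _) (m a)
    have h2 : Order.succ a = Ordinal.omega0 * (a / Ordinal.omega0) + ((m a + 1 : ℕ) : Ordinal) := by
      rw [Nat.cast_add, Nat.cast_one, ← add_assoc, hdecomp, Order.succ_eq_add_one]
    rw [h2, hT]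
    exact h

/-! ### Exact supports in a projective differential module -/

/-- Let `M` carry an endomorphism `d`, and let `π` and `s` exhibit `M` as a retract of the free
module on `B`. A set `S` of basis elements is an exact support if the free submodule on `S` is
stable under `s ∘ d ∘ π`, and every cycle in the image of this submodule is the boundary of an
element of that image. Stability under `s ∘ π` is not required. -/
structure IsExactSupport {R M B : Type*} [Ring R] [AddCommGroup M] [Module R M]
    (d : M →ₗ[R] M) (π : (B →₀ R) →ₗ[R] M) (s : M →ₗ[R] (B →₀ R)) (S : Set B) : Prop where
  map_mem : ∀ x ∈ Finsupp.supported R R S, s (d (π x)) ∈ Finsupp.supported R R S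
  exact : ∀ x ∈ Finsupp.supported R R S, d (π x) = 0 →
    ∃ y ∈ Finsupp.supported R R S, d (π y) = π x

theorem Finsupp.mem_supported_iff_lsubtypeDomain_compl_eq_zero {R B : Type*} [Ring R] (S : Set B)
    (x : B →₀ R) : x ∈ Finsupp.supported R R S ↔
      Finsupp.lsubtypeDomain (R := R) (M := R) Sᶜ x = 0 := by
  rw [Finsupp.mem_supported', Finsupp.ext_iff]
  exact ⟨fun h i => h i i.2, fun h i hi => h ⟨i, hi⟩⟩

theorem Finsupp.fg_supported_finset {R B : Type*} [Ring R] (X : Finset B) :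
    (Finsupp.supported R R (X : Set B)).FG := by
  rw [Finsupp.supported_eq_span_single]
  exact Submodule.fg_span (X.finite_toSet.image _)

theorem Finsupp.exists_mem_supported_of_mem_iUnion {R B : Type*} [Ring R] {T : ℕ → Set B}
    (hT : Monotone T) {x : B →₀ R} (hx : x ∈ Finsupp.supported R R (⋃ k, T k)) :
    ∃ k, x ∈ Finsupp.supported R R (T k) := by
  rw [Finsupp.supported_iUnion] at hx
  exact (Submodule.mem_iSup_of_directed _
    (Monotone.directed_le fun _ _ h => Finsupp.supported_mono (hT h))).1 hx

section

variable {R M B : Type*} [Ring R] [AddCommGroup M] [Module R M]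
  {d : M →ₗ[R] M} {π : (B →₀ R) →ₗ[R] M} {s : M →ₗ[R] (B →₀ R)} {S : Set B}

theorem isExactSupport_empty : IsExactSupport d π s (∅ : Set B) := by
  constructor
  · intro x hx
    obtain rfl : x = 0 := by simpa using hx
    simp
  · intro x hx _
    obtain rfl : x = 0 := by simpa using hx
    exact ⟨0, by simp, by simp⟩

theorem isExactSupport_sSup {c : Set (Set B)} (hne : c.Nonempty) (hc : IsChain (· ≤ ·) c)
    (h : ∀ S ∈ c, IsExactSupport d π s S) : IsExactSupport d π s (sSup c) := by
  have : Nonempty c := hne.to_subtype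
  have key : ∀ x ∈ Finsupp.supported R R (sSup c), ∃ S ∈ c, x ∈ Finsupp.supported R R S := by
    intro x hx
    rw [Set.sSup_eq_sUnion, Set.sUnion_eq_iUnion, Finsupp.supported_iUnion] at hx
    have hdir : Directed (· ≤ ·) fun S : c => Finsupp.supported R R (S : Set B) := by
      intro S T
      rcases hc.total S.2 T.2 with h | h
      · exact ⟨T, Finsupp.supported_mono h, le_rfl⟩
      · exact ⟨S, le_rfl, Finsupp.supported_mono h⟩
    obtain ⟨S, hS⟩ := (Submodule.mem_iSup_of_directed _ hdir).1 hx
    exact ⟨S, S.2, hS⟩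
  constructor
  · intro x hx
    obtain ⟨S, hS, hxS⟩ := key x hx
    exact Finsupp.supported_mono (le_sSup hS) ((h S hS).map_mem x hxS)
  · intro x hx hx0
    obtain ⟨S, hS, hxS⟩ := key x hx
    obtain ⟨y, hy, e⟩ := (h S hS).exact x hxS hx0
    exact ⟨y, Finsupp.supported_mono (le_sSup hS) hy, e⟩

/-- Over a left coherent ring, finitely many basis elements suffice to bound all cycles supported on
`S ∪ X`, where `S` is an exact support and `X` is finite. -/
theorem IsExactSupport.exists_finset
    (hR : ∀ I : Submodule R R, I.FG → Module.FinitePresentation R I)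
    (hd : ∀ x, d x = 0 ↔ ∃ y, d y = x) (hπ : ∀ x, π (s x) = x)
    (hS : IsExactSupport d π s S) (X : Finset B) :
    ∃ X' : Finset B, X ⊆ X' ∧
      (∀ x ∈ Finsupp.supported R R (S ∪ X), s (d (π x)) ∈ Finsupp.supported R R (S ∪ X')) ∧
      ∀ x ∈ Finsupp.supported R R (S ∪ X), d (π x) = 0 →
        ∃ y ∈ Finsupp.supported R R (S ∪ X'), d (π y) = π x := by
  classical
  have hdd : ∀ x, d (d x) = 0 := fun x => (hd _).2 ⟨x, rfl⟩
  let f : (B →₀ R) →ₗ[R] ((Sᶜ : Set B) →₀ R) := Finsupp.lsubtypeDomain Sᶜ ∘ₗ s ∘ₗ d ∘ₗ π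
  have hf : ∀ x, f x = 0 ↔ s (d (π x)) ∈ Finsupp.supported R R S := fun x =>
    (Finsupp.mem_supported_iff_lsubtypeDomain_compl_eq_zero S _).symm
  -- the chains on `X` that are cycles modulo `S` form a finitely generated module, by coherence
  obtain ⟨t, ht⟩ := Submodule.fg_inf_ker_of_finitePresentation_map f
    (Finsupp.supported R R (X : Set B)) (Finsupp.fg_supported_finset X)
    (finitePresentation_of_fg_submodule_finsupp hR _ ((Finsupp.fg_supported_finset X).map f))
  -- exactness of `S` corrects each relative cycle `k` to a cycle `k - y`, which bounds some `w`
  have hcorr : ∀ k ∈ t, ∃ w : B →₀ R, ∃ y ∈ Finsupp.supported R R S, d (π w) = π k - π y := by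
    intro k hk
    have hk' : s (d (π k)) ∈ Finsupp.supported R R S :=
      (hf k).1 ((ht ▸ Submodule.subset_span hk :
        k ∈ Finsupp.supported R R (X : Set B) ⊓ LinearMap.ker f).2)
    obtain ⟨y, hy, hyk⟩ := hS.exact _ hk' (by rw [hπ, hdd])
    rw [hπ] at hyk
    obtain ⟨m, hm⟩ := (hd (π k - π y)).1 (by rw [map_sub, hyk, sub_self])
    exact ⟨s m, y, hy, by rw [hπ, hm]⟩
  choose! w y hy hw using hcorr
  let X' : Finset B := X ∪ X.biUnion (fun b => (s (d (π (Finsupp.single b 1)))).support) ∪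
    t.biUnion (fun k => (w k).support)
  have hXX' : X ⊆ X' := Finset.subset_union_left.trans Finset.subset_union_left
  have hSX' : Finsupp.supported R R S ≤ Finsupp.supported R R (S ∪ X') :=
    Finsupp.supported_mono Set.subset_union_left
  have hwX' : ∀ k ∈ t, w k ∈ Finsupp.supported R R (S ∪ X') := by
    intro k hk
    rw [Finsupp.mem_supported]
    refine Set.subset_union_of_subset_right (Finset.coe_subset.2 ?_) _
    exact (Finset.subset_biUnion_of_mem (fun k => (w k).support) hk).trans
      Finset.subset_union_right
  have hspan : ∀ k ∈ Submodule.span R (t : Set (B →₀ R)),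
      ∃ w ∈ Finsupp.supported R R (S ∪ X'), ∃ y ∈ Finsupp.supported R R S,
        d (π w) = π k - π y := by
    intro k hk
    induction hk using Submodule.span_induction with
    | mem k hk => exact ⟨w k, hwX' k hk, y k, hy k hk, hw k hk⟩
    | zero => exact ⟨0, zero_mem _, 0, zero_mem _, by simp⟩
    | add k₁ k₂ _ _ h₁ h₂ =>
      obtain ⟨w₁, hw₁, y₁, hy₁, e₁⟩ := h₁
      obtain ⟨w₂, hw₂, y₂, hy₂, e₂⟩ := h₂
      refine ⟨w₁ + w₂, add_mem hw₁ hw₂, y₁ + y₂, add_mem hy₁ hy₂, ?_⟩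
      simp only [map_add, e₁, e₂]
      abel
    | smul r k _ h =>
      obtain ⟨w, hw, y, hy, e⟩ := h
      exact ⟨r • w, Submodule.smul_mem _ _ hw, r • y, Submodule.smul_mem _ _ hy,
        by simp only [map_smul, e, smul_sub]⟩
  refine ⟨X', hXX', ?_, ?_⟩
  · intro x hx
    have hle : Finsupp.supported R R (S ∪ X) ≤
        (Finsupp.supported R R (S ∪ X')).comap (s ∘ₗ d ∘ₗ π) := by
      rw [Finsupp.supported_union, sup_le_iff]
      refine ⟨fun x hx => hSX' (hS.map_mem x hx), ?_⟩
      rw [Finsupp.supported_eq_span_single, Submodule.span_le]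
      rintro _ ⟨b, hb, rfl⟩
      change s (d (π (Finsupp.single b 1))) ∈ Finsupp.supported R R (S ∪ X')
      rw [Finsupp.mem_supported]
      refine Set.subset_union_of_subset_right (Finset.coe_subset.2 ?_) _
      exact (Finset.subset_biUnion_of_mem
        (fun b => (s (d (π (Finsupp.single b 1)))).support) hb).trans
        (Finset.subset_union_right.trans Finset.subset_union_left)
    exact hle hx
  · intro x hx hx0
    rw [Finsupp.supported_union] at hx
    obtain ⟨z, hz, k, hk, rfl⟩ := Submodule.mem_sup.1 hx
    rw [map_add, map_add] at hx0
    have hkK : k ∈ Submodule.span R (t : Set (B →₀ R)) := by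
      rw [ht]
      refine ⟨hk, (hf k).2 ?_⟩
      rw [eq_neg_of_add_eq_zero_right hx0, map_neg]
      exact neg_mem (hS.map_mem z hz)
    obtain ⟨w, hw, y, hy, e⟩ := hspan k hkK
    have hyk : d (π k) = d (π y) := by
      have := hdd (π w)
      rwa [e, map_sub, sub_eq_zero] at this
    obtain ⟨v, hv, ev⟩ := hS.exact (z + y) (add_mem hz hy) (by
      rw [map_add, map_add, ← hyk, hx0])
    refine ⟨v + w, add_mem (hSX' hv) hw, ?_⟩
    rw [map_add, map_add, ev, e, map_add, map_add]
    abel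

/-- The map `d ∘ π`, with the cycles `ker d` as codomain. -/
noncomputable def boundaryMap (hd : ∀ x, d x = 0 ↔ ∃ y, d y = x) (π : (B →₀ R) →ₗ[R] M) :
    (B →₀ R) →ₗ[R] LinearMap.ker d :=
  (d ∘ₗ π).codRestrict (LinearMap.ker d) fun x => (hd _).2 ⟨π x, rfl⟩

theorem boundaryMap_surjective (hd : ∀ x, d x = 0 ↔ ∃ y, d y = x) (hπ : ∀ x, π (s x) = x) :
    Function.Surjective (boundaryMap hd π) := by
  rintro ⟨x, hx⟩
  obtain ⟨y, rfl⟩ := (hd x).1 hx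
  exact ⟨s y, Subtype.ext (congrArg d (hπ y))⟩

/-- Restricting `s` to the coordinates outside `S` kills exactly the boundaries supported on `S`,
because `S` is an exact support; so boundaries modulo these embed into a free module. -/
theorem IsExactSupport.finitePresentation_quotient
    (hR : ∀ I : Submodule R R, I.FG → Module.FinitePresentation R I)
    (hd : ∀ x, d x = 0 ↔ ∃ y, d y = x) (hπ : ∀ x, π (s x) = x)
    (hS : IsExactSupport d π s S) {X X' : Finset B} (hX : X ⊆ X') :
    Module.FinitePresentation R
      ((Finsupp.supported R R (S ∪ X')).map (boundaryMap hd π) ⧸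
        ((Finsupp.supported R R (S ∪ X)).map (boundaryMap hd π)).submoduleOf
          ((Finsupp.supported R R (S ∪ X')).map (boundaryMap hd π))) := by
  let f : LinearMap.ker d →ₗ[R] ((Sᶜ : Set B) →₀ R) :=
    Finsupp.lsubtypeDomain Sᶜ ∘ₗ s ∘ₗ (LinearMap.ker d).subtype
  have hf : ∀ x : LinearMap.ker d, f x = 0 ↔ s (x : M) ∈ Finsupp.supported R R S := fun x =>
    (Finsupp.mem_supported_iff_lsubtypeDomain_compl_eq_zero S _).symm
  have hfg : ∀ X : Finset B,
      (((Finsupp.supported R R (S ∪ X)).map (boundaryMap hd π)).map f).FG := by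
    intro X
    have h0 : ((Finsupp.supported R R S).map (boundaryMap hd π)).map f = ⊥ := by
      rw [eq_bot_iff]
      rintro _ ⟨_, ⟨x, hx, rfl⟩, rfl⟩
      exact (hf _).2 (hS.map_mem x hx)
    rw [Finsupp.supported_union, Submodule.map_sup, Submodule.map_sup, h0, bot_sup_eq]
    exact ((Finsupp.fg_supported_finset X).map _).map _
  refine finitePresentation_quotient_of_fg_map
    (finitePresentation_of_fg_submodule_finsupp hR) f
    (Submodule.map_mono (Finsupp.supported_mono
      (Set.union_subset_union_right S (Finset.coe_subset.2 hX)))) ?_ (hfg X) (hfg X')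
  intro w _ hw
  obtain ⟨y, hy, e⟩ := hS.exact _ ((hf w).1 hw) (by rw [hπ]; exact w.2)
  exact ⟨y, Finsupp.supported_mono Set.subset_union_left hy, Subtype.ext (e.trans (hπ _))⟩

/-- Over a left coherent ring, every exact support other than the whole basis extends to a
strictly larger one by countably many finite steps, and the boundaries then grow by finitely
presented factors. -/
theorem IsExactSupport.exists_nat_chain
    (hR : ∀ I : Submodule R R, I.FG → Module.FinitePresentation R I)
    (hd : ∀ x, d x = 0 ↔ ∃ y, d y = x) (hπ : ∀ x, π (s x) = x)
    (hS : IsExactSupport d π s S) :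
    ∃ T : ℕ → Set B, T 0 = S ∧ Monotone T ∧ IsExactSupport d π s (⨆ k, T k) ∧
      (S ≠ ⊤ → S < ⨆ k, T k) ∧
      ∀ k, Module.FinitePresentation R
        ((Finsupp.supported R R (T (k + 1))).map (boundaryMap hd π) ⧸
          ((Finsupp.supported R R (T k)).map (boundaryMap hd π)).submoduleOf
            ((Finsupp.supported R R (T (k + 1))).map (boundaryMap hd π))) := by
  classical
  -- `Y` contributes a basis element outside `S`, to make the chain grow
  obtain ⟨Y, hY⟩ : ∃ Y : Finset B, S ≠ ⊤ → ∃ b ∈ Y, b ∉ S := by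
    by_cases h : S = ⊤
    · exact ⟨∅, fun h' => absurd h h'⟩
    · obtain ⟨b, hb⟩ := (Set.ne_univ_iff_exists_notMem S).1 h
      exact ⟨{b}, fun _ => ⟨b, Finset.mem_singleton_self b, hb⟩⟩
  choose next hnext hmap hexact using hS.exists_finset hR hd hπ
  obtain ⟨X, hX0, hX⟩ : ∃ X : ℕ → Finset B, X 0 = ∅ ∧ ∀ k, X (k + 1) = next (X k ∪ Y) :=
    ⟨fun k => Nat.rec ∅ (fun _ X => next (X ∪ Y)) k, rfl, fun _ => rfl⟩
  have hX1 : ∀ k, X k ∪ Y ⊆ X (k + 1) := fun k => (hX k).symm ▸ hnext _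
  have hXs : ∀ k, X k ⊆ X (k + 1) := fun k => Finset.subset_union_left.trans (hX1 k)
  let T : ℕ → Set B := fun k => S ∪ X k
  have hTm : Monotone T := monotone_nat_of_le_succ fun k =>
    Set.union_subset_union_right S (Finset.coe_subset.2 (hXs k))
  have hTle : ∀ k, T k ≤ ⨆ k, T k := le_iSup T
  have hmono : ∀ k, S ∪ (X k : Set B) ⊆ S ∪ ((X k ∪ Y : Finset B) : Set B) := fun k =>
    Set.union_subset_union_right S (Finset.coe_subset.2 Finset.subset_union_left)
  refine ⟨T, ?_, hTm, ⟨?_, ?_⟩, ?_, fun k => hS.finitePresentation_quotient hR hd hπ (hXs k)⟩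
  · simp [T, hX0]
  · intro x hx
    obtain ⟨k, hk⟩ := Finsupp.exists_mem_supported_of_mem_iUnion hTm hx
    have hmap' := hmap (X k ∪ Y)
    rw [← hX k] at hmap'
    exact Finsupp.supported_mono (hTle (k + 1))
      (hmap' x (Finsupp.supported_mono (hmono k) hk))
  · intro x hx hx0
    obtain ⟨k, hk⟩ := Finsupp.exists_mem_supported_of_mem_iUnion hTm hx
    have hexact' := hexact (X k ∪ Y)
    rw [← hX k] at hexact'
    obtain ⟨y, hy, e⟩ := hexact' x (Finsupp.supported_mono (hmono k) hk) hx0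
    exact ⟨y, Finsupp.supported_mono (hTle (k + 1)) hy, e⟩
  · intro hne
    obtain ⟨b, hbY, hbS⟩ := hY hne
    refine lt_of_le_of_ne (Set.subset_union_left.trans (hTle 0)) fun h => hbS ?_
    rw [h]
    exact hTle 1 (Or.inr (hX1 0 (Finset.mem_union_right _ hbY)))

end

/-- Over a left coherent ring, the cycles of an exact projective differential module form a
transfinite extension of finitely presented modules. -/
theorem isTransfiniteExtension_ker {R : Type u} [Ring R]
    (hR : ∀ I : Submodule R R, I.FG → Module.FinitePresentation R I)
    {M : Type u} [AddCommGroup M] [Module R M] [Module.Projective R M] (d : M →ₗ[R] M)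
    (hd : ∀ x, d x = 0 ↔ ∃ y, d y = x) :
    IsTransfiniteExtension (finitelyPresentedModules R) (ModuleCat.of R (LinearMap.ker d)) := by
  obtain ⟨s, hs⟩ := Module.projective_def.1 (inferInstance : Module.Projective R M)
  let π : (M →₀ R) →ₗ[R] M := Finsupp.linearCombination R id
  let N : Set M → Submodule R (LinearMap.ker d) := fun S =>
    (Finsupp.supported R R S).map (boundaryMap hd π)
  have hNm : Monotone N := fun S T h => Submodule.map_mono (Finsupp.supported_mono h)
  obtain ⟨o, T, hTm, hT0, hTo, hTl, hTs⟩ := exists_ordinal_chain (IsExactSupport d π s)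
    (fun S T => Module.FinitePresentation R (N T ⧸ (N S).submoduleOf (N T)))
    isExactSupport_empty (fun c hne hc h => isExactSupport_sSup hne hc h)
    (fun S hS => hS.exists_nat_chain hR hd hs)
  refine ⟨o, fun a => N (T a), hNm.comp hTm, ?_, ?_, ?_, fun a _ => hTs a⟩
  · simp [hT0, N]
  · change N (T o) = ⊤
    rw [hTo]
    simp only [N, Set.top_eq_univ, Finsupp.supported_univ, Submodule.map_top]
    exact LinearMap.range_eq_top.2 (boundaryMap_surjective hd hs)
  · intro l _ hl
    change N (T l) = ⨆ a : Set.Iio l, N (T a)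
    rw [hTl l hl]
    simp only [N, Set.iSup_eq_iUnion, Finsupp.supported_iUnion, Submodule.map_iSup]

/-! ### Eklof's lemma -/

section
variable {R : Type u} [Ring R]

open Abelian in
theorem exists_extend_of_subsingleton_ext {Y Q : Type u} [AddCommGroup Y] [Module R Y]
    [AddCommGroup Q] [Module R Q] {f : Y →ₗ[R] Q} (hf : Function.Surjective f)
    (A : ModuleCat.{u} R) (hA : Subsingleton (Ext.{u} (ModuleCat.of R Q) A 1))
    (g : LinearMap.ker f →ₗ[R] A) : ∃ g' : Y →ₗ[R] A, ∀ x : LinearMap.ker f, g' x = g x := by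
  have hS := LinearMap.shortExact_shortComplexKer hf
  obtain ⟨x, hx⟩ := Ext.contravariant_sequence_exact₁ hS A
    (Ext.mk₀ (ModuleCat.ofHom g)) (add_zero 1) (hA.elim _ _)
  obtain ⟨h, rfl⟩ := Ext.addEquiv₀.symm.surjective x
  have hx' : f.shortComplexKer.f ≫ h = ModuleCat.ofHom g := by
    apply Ext.addEquiv₀.symm.injective
    simpa using hx
  exact ⟨h.hom, fun y => congrArg (fun t => t.hom y) hx'⟩

open Abelian in
theorem subsingleton_ext_of_exists_extend {Y Q : Type u} [AddCommGroup Y] [Module R Y]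
    [Module.Projective R Y] [AddCommGroup Q] [Module R Q] {f : Y →ₗ[R] Q}
    (hf : Function.Surjective f) (A : ModuleCat.{u} R)
    (h : ∀ g : LinearMap.ker f →ₗ[R] A, ∃ g' : Y →ₗ[R] A, ∀ x : LinearMap.ker f, g' x = g x) :
    Subsingleton (Ext.{u} (ModuleCat.of R Q) A 1) := by
  have hS := LinearMap.shortExact_shortComplexKer hf
  have : Projective f.shortComplexKer.X₂ :=
    (inferInstance : Projective (ModuleCat.of R Y))
  refine subsingleton_of_forall_eq 0 fun x => ?_
  obtain ⟨y, rfl⟩ := Ext.contravariant_sequence_exact₃ hS A x (Ext.eq_zero_of_projective _)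
    (add_zero 1)
  obtain ⟨g, rfl⟩ := Ext.addEquiv₀.symm.surjective y
  obtain ⟨g', hg'⟩ := h g.hom
  have hg : g = f.shortComplexKer.f ≫ ModuleCat.ofHom g' := by
    ext y
    exact (hg' y).symm
  rw [hg]
  simp only [Ext.addEquiv₀_symm_apply]
  rw [← Ext.mk₀_comp_mk₀]
  exact hS.extClass_comp_assoc _ 

theorem subsingleton_ext_of_retract {X Y : ModuleCat.{u} R} (r : Retract X Y) (A : ModuleCat.{u} R)
    (n : ℕ) (h : Subsingleton (Abelian.Ext.{u} Y A n)) :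
    Subsingleton (Abelian.Ext.{u} X A n) := by
  refine subsingleton_of_forall_eq 0 fun x => ?_
  have hx : (Abelian.Ext.mk₀ r.i).comp ((Abelian.Ext.mk₀ r.r).comp x (zero_add n)) (zero_add n) =
      x := by
    rw [Abelian.Ext.mk₀_comp_mk₀_assoc, r.retract, Abelian.Ext.mk₀_id_comp]
  rw [← hx, h.elim ((Abelian.Ext.mk₀ r.r).comp x (zero_add n)) 0, Abelian.Ext.comp_zero]

end

/-- Partial linear maps extend along a continuous ordinal chain of domains if they extend along each
successor step. Zorn's lemma is applied to the extensions whose domain is a member of the chain. -/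
theorem LinearPMap.exists_extend_of_ordinal_chain {R F A : Type*} [Ring R] [AddCommGroup F]
    [Module R F] [AddCommGroup A] [Module R A] (o : Ordinal.{u}) (N : Ordinal.{u} → Submodule R F)
    (hN : Monotone N)
    (hlim : ∀ l ≤ o, Order.IsSuccLimit l → N l = ⨆ a : Set.Iio l, N a)
    (hsucc : ∀ a < o, ∀ p : F →ₗ.[R] A, p.domain = N a →
      ∃ q, p ≤ q ∧ q.domain = N (Order.succ a))
    (p : F →ₗ.[R] A) (hp : p.domain = N 0) : ∃ q, p ≤ q ∧ q.domain = N o := by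
  obtain ⟨m, hpm, hm⟩ := zorn_le_nonempty₀ {q : F →ₗ.[R] A | ∃ a ≤ o, q.domain = N a} (by
    intro c hcs hc y hy
    have hdir : DirectedOn (· ≤ ·) c := hc.directedOn
    refine ⟨LinearPMap.sSup c hdir, ?_, fun z hz => LinearPMap.le_sSup hdir hz⟩
    have hex : ∃ b, b ≤ o ∧ ∀ q ∈ c, q.domain ≤ N b := by
      refine ⟨o, le_rfl, fun q hq => ?_⟩
      obtain ⟨a, ha, e⟩ := hcs hq
      exact e.trans_le (hN ha)
    -- `b` is the least index whose module contains all domains in `c`; their union is then `N b`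
    let b := sInf {b | b ≤ o ∧ ∀ q ∈ c, q.domain ≤ N b}
    obtain ⟨hbo, hb⟩ : b ≤ o ∧ ∀ q ∈ c, q.domain ≤ N b := csInf_mem hex
    have hlt : ∀ a < b, ∃ q ∈ c, N (Order.succ a) ≤ q.domain := by
      intro a hab
      have : ¬ (a ≤ o ∧ ∀ q ∈ c, q.domain ≤ N a) := fun h => notMem_of_lt_csInf' hab h
      push Not at this
      obtain ⟨q, hq, hqa⟩ := this (hab.le.trans hbo)
      obtain ⟨a', _, e⟩ := hcs hq
      refine ⟨q, hq, ?_⟩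
      rw [e] at hqa ⊢
      exact hN (Order.succ_le_of_lt (lt_of_not_ge fun h => hqa (hN h)))
    refine ⟨b, hbo, le_antisymm ?_ ?_⟩
    · rw [LinearPMap.domain_sSup]
      refine sSup_le ?_
      rintro _ ⟨q, hq, rfl⟩
      exact hb q hq
    · rcases Ordinal.zero_or_succ_or_isSuccLimit b with h0 | ⟨a, ha⟩ | hl
      · obtain ⟨a, _, e⟩ := hcs hy
        rw [h0]
        exact (hN zero_le).trans (e.ge.trans (LinearPMap.le_sSup hdir hy).1)
      · obtain ⟨q, hq, h⟩ := hlt a (ha ▸ Order.lt_succ a)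
        rw [← ha]
        exact h.trans (LinearPMap.le_sSup hdir hq).1
      · rw [hlim b hbo hl]
        refine iSup_le fun a => ?_
        obtain ⟨q, hq, h⟩ := hlt a a.2
        exact (hN (Order.le_succ _)).trans (h.trans (LinearPMap.le_sSup hdir hq).1))
    p ⟨0, zero_le, hp⟩
  obtain ⟨a, hao, hma⟩ := hm.prop
  have hle : ∀ b ≤ o, N b ≤ m.domain := by
    intro b
    induction b using Ordinal.limitRecOn with
    | zero => exact fun _ => hma ▸ hN zero_le
    | add_one b ih =>
      rw [← Order.succ_eq_add_one]
      intro hbo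
      have hbo' : b < o := Order.succ_le_iff.1 hbo
      rcases lt_or_ge b a with h | h
      · exact hma ▸ hN (Order.succ_le_of_lt h)
      · obtain ⟨q, hmq, hq⟩ := hsucc b hbo' m
          (le_antisymm (hma.trans_le (hN h)) (ih hbo'.le))
        exact hq ▸ (hm.le_of_ge ⟨_, hbo, hq⟩ hmq).1
    | limit b hb ih =>
      intro hbo
      rw [hlim b hbo hb]
      exact iSup_le fun x => ih x x.2 ((le_of_lt x.2).trans hbo)
  exact ⟨m, hpm, le_antisymm (hma.trans_le (hN hao)) (hle o le_rfl)⟩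

/-- The successor step of Eklof's lemma: the kernel of `f ⁻¹(W) → W / V` is `f ⁻¹(V)`. -/
theorem LinearPMap.exists_extend_comap {R : Type u} [Ring R] {Y M : Type u} [AddCommGroup Y]
    [Module R Y] [AddCommGroup M] [Module R M] {f : Y →ₗ[R] M} (hf : Function.Surjective f)
    {V W : Submodule R M} (hVW : V ≤ W) (A : ModuleCat.{u} R)
    (hA : Subsingleton (Abelian.Ext.{u} (ModuleCat.of R (W ⧸ V.submoduleOf W)) A 1))
    (p : Y →ₗ.[R] A) (hp : p.domain = V.comap f) : ∃ q, p ≤ q ∧ q.domain = W.comap f := by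
  obtain ⟨D, p⟩ := p
  obtain rfl : D = _ := hp
  let φ : W.comap f →ₗ[R] W ⧸ V.submoduleOf W := Submodule.mkQ _ ∘ₗ f.restrict fun x hx => hx
  have hφ : Function.Surjective φ := by
    refine (Submodule.mkQ_surjective _).comp ?_
    rintro ⟨y, hy⟩
    obtain ⟨x, rfl⟩ := hf y
    exact ⟨⟨x, hy⟩, rfl⟩
  have hker : ∀ x, φ x = 0 ↔ f x ∈ V := fun x => Submodule.Quotient.mk_eq_zero _
  obtain ⟨q, hq⟩ := exists_extend_of_subsingleton_ext hφ A hA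
    (p ∘ₗ LinearMap.codRestrict (V.comap f) (Submodule.subtype _ ∘ₗ (LinearMap.ker φ).subtype)
      fun x => (hker x).1 x.2)
  refine ⟨⟨_, q⟩, ⟨Submodule.comap_mono hVW, ?_⟩, rfl⟩
  rintro ⟨x, hx⟩ ⟨y, hy⟩ (rfl : x = y)
  exact (hq ⟨⟨x, hy⟩, (hker _).2 hx⟩).symm

theorem IsTransfiniteExtension.exists_extend {R : Type u} [Ring R]
    {S : ObjectProperty (ModuleCat.{u} R)} {M : ModuleCat.{u} R} (hM : IsTransfiniteExtension S M)
    (A : ModuleCat.{u} R) (hA : ∀ Q, S Q → Subsingleton (Abelian.Ext.{u} Q A 1))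
    {Y : Type u} [AddCommGroup Y] [Module R Y] {f : Y →ₗ[R] M} (hf : Function.Surjective f)
    (g : LinearMap.ker f →ₗ[R] A) : ∃ g' : Y →ₗ[R] A, ∀ x : LinearMap.ker f, g' x = g x := by
  obtain ⟨o, N, hNm, hN0, hNo, hNl, hNs⟩ := hM
  have hlim : ∀ l ≤ o, Order.IsSuccLimit l →
      (N l).comap f = ⨆ a : Set.Iio l, (N a).comap f := by
    intro l hl hlim
    refine le_antisymm ?_ (iSup_le fun a => Submodule.comap_mono (hNm (le_of_lt a.2)))
    intro x hx
    have : Nonempty (Set.Iio l) := ⟨⟨0, hlim.bot_lt⟩⟩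
    have hx' : f x ∈ ⨆ a : Set.Iio l, N a := hNl l hl hlim ▸ hx
    have hdir : Directed (· ≤ ·) fun a : Set.Iio l => N a :=
      Monotone.directed_le fun a b h => hNm h
    obtain ⟨a, ha⟩ := (Submodule.mem_iSup_of_directed _ hdir).1 hx'
    exact Submodule.mem_iSup_of_mem a ha
  obtain ⟨q, hgq, hq⟩ := LinearPMap.exists_extend_of_ordinal_chain o
    (fun a => (N a).comap f) (fun a b h => Submodule.comap_mono (hNm h)) hlim
    (fun a ha => LinearPMap.exists_extend_comap hf (hNm (Order.le_succ a)) A (hA _ (hNs a ha)))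
    (⟨LinearMap.ker f, g⟩ : Y →ₗ.[R] A) (by rw [hN0]; rfl)
  have hq' : q.domain = ⊤ := by rw [hq, hNo, Submodule.comap_top]
  refine ⟨q.toFun ∘ₗ LinearMap.codRestrict q.domain LinearMap.id (fun x => hq' ▸ trivial), ?_⟩
  intro x
  exact (hgq.2 (x := x) rfl).symm

/-- Eklof's lemma: if `Ext¹(Q, A) = 0` for all `Q` in `S`, then `Ext¹(M, A) = 0` for every transfinite
extension `M` of modules in `S`. -/
theorem IsTransfiniteExtension.subsingleton_ext {R : Type u} [Ring R]
    {S : ObjectProperty (ModuleCat.{u} R)} {M : ModuleCat.{u} R} (hM : IsTransfiniteExtension S M)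
    (A : ModuleCat.{u} R) (hA : ∀ Q, S Q → Subsingleton (Abelian.Ext.{u} Q A 1)) :
    Subsingleton (Abelian.Ext.{u} M A 1) :=
  have hf := Finsupp.linearCombination_id_surjective R M
  subsingleton_ext_of_exists_extend hf A (hM.exists_extend A hA hf)

/-! ### The total differential module of a complex -/

open scoped DirectSum

section
variable {R : Type u} [Ring R] (P : ChainComplex (ModuleCat.{u} R) ℤ)

/-- The differential of the complex, as an endomorphism of the direct sum of all its terms. -/
noncomputable def ChainComplex.totalDifferential : (⨁ n : ℤ, P.X n) →ₗ[R] ⨁ n : ℤ, P.X n :=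
  DirectSum.toModule R ℤ _ fun n =>
    DirectSum.lof R ℤ (fun n => P.X n) (n - 1) ∘ₗ
    (P.d n (n - 1)).hom

theorem ChainComplex.totalDifferential_lof {i j : ℤ} (h : j + 1 = i) (x : P.X i) :
    P.totalDifferential (DirectSum.lof R ℤ (fun n => P.X n) i x) =
      DirectSum.lof R ℤ (fun n => P.X n) j (P.d i j x) := by
  obtain rfl : j = i - 1 := by lia
  simp [totalDifferential, DirectSum.toModule_lof]

theorem ChainComplex.totalDifferential_apply {i j : ℤ} (h : j + 1 = i) (x : ⨁ n : ℤ, P.X n) :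
    P.totalDifferential x j = P.d i j (x i) := by
  induction x using DirectSum.induction_on with
  | zero => simp
  | add x y hx hy => simp [hx, hy]
  | of k x =>
    have := P.totalDifferential_lof (i := k) (j := k - 1) (by lia) x
    simp only [DirectSum.lof_eq_of] at this
    rw [this]
    by_cases hk : k = i
    · obtain rfl := hk
      obtain rfl : j = k - 1 := by lia
      simp
    · rw [DirectSum.of_eq_of_ne _ _ _ (by lia), DirectSum.of_eq_of_ne _ _ _ (by lia), map_zero]

theorem ChainComplex.totalDifferential_eq_zero_iff (hP : ∀ n, P.ExactAt n) (x : ⨁ n : ℤ, P.X n) :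
    P.totalDifferential x = 0 ↔ ∃ y, P.totalDifferential y = x := by
  classical
  constructor
  · intro hx
    have hex : ∀ n, ∃ y : P.X (n + 1), P.d (n + 1) n y = x n := by
      intro n
      have h := (P.exactAt_iff' (n + 1) n (n - 1)
        (ComplexShape.prev_eq' _ (by simp)) (ComplexShape.next_eq' _ (by simp))).1 (hP n)
      refine (ShortComplex.moduleCat_exact_iff _).1 h (x n) ?_
      change P.d n (n - 1) (x n) = 0
      rw [← P.totalDifferential_apply (by lia), hx, DirectSum.zero_apply]
    choose y hy using hex
    refine ⟨∑ n ∈ DFinsupp.support x, DirectSum.lof R ℤ (fun n => P.X n) (n + 1) (y n), ?_⟩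
    rw [map_sum]
    refine (Finset.sum_congr rfl fun n _ => ?_).trans (DirectSum.sum_support_of x)
    rw [P.totalDifferential_lof rfl, hy, DirectSum.lof_eq_of]
  · rintro ⟨y, rfl⟩
    refine DFinsupp.ext fun n => ?_
    change P.totalDifferential _ n = 0
    rw [P.totalDifferential_apply rfl, P.totalDifferential_apply rfl, ← ModuleCat.comp_apply,
      P.d_comp_d]
    rfl

theorem ChainComplex.totalDifferential_lof_iCycles (n : ℤ) (x : P.cycles n) :
    P.totalDifferential (DirectSum.lof R ℤ (fun n => P.X n) n (P.iCycles n x)) = 0 := by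
  rw [P.totalDifferential_lof (sub_add_cancel n 1), ← ModuleCat.comp_apply, P.iCycles_d]
  exact map_zero _

/-- The inclusion of the degree `n` cycles into the cycles of the total differential. -/
noncomputable def ChainComplex.cyclesToKerTotalDifferential (n : ℤ) :
    P.cycles n ⟶ ModuleCat.of R (LinearMap.ker P.totalDifferential) :=
  ModuleCat.ofHom <| LinearMap.codRestrict (LinearMap.ker P.totalDifferential)
    (DirectSum.lof R ℤ (fun n => P.X n) n ∘ₗ (P.iCycles n).hom)
    (P.totalDifferential_lof_iCycles n)

/-- The degree `n` cycles are a retract of the cycles of the total differential; the retraction takes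
the degree `n` component. -/
noncomputable def ChainComplex.cyclesRetractKerTotalDifferential (n : ℤ) :
    Retract (P.cycles n) (ModuleCat.of R (LinearMap.ker P.totalDifferential)) where
  i := P.cyclesToKerTotalDifferential n
  r := P.liftCycles (ModuleCat.ofHom (DirectSum.component R ℤ (fun n => P.X n) n ∘ₗ
    (LinearMap.ker P.totalDifferential).subtype)) (n - 1) (ComplexShape.next_eq' _ (by simp)) (by
      ext x
      have h := P.totalDifferential_apply (sub_add_cancel n 1) (x : ⨁ n : ℤ, P.X n)
      rw [LinearMap.mem_ker.1 x.2] at h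
      exact h.symm)
  retract := by
    rw [← cancel_mono (P.iCycles n), Category.assoc, HomologicalComplex.liftCycles_i,
      Category.id_comp]
    ext x
    exact DirectSum.component.lof_self R n _

end

theorem theorem3p6 {R : Type u} [Ring R] (hR : IsCoherentRing R)
    (P : ChainComplex (ModuleCat.{u} R) ℤ)
    (hproj : ∀ n : ℤ, Module.Projective R (P.X n))
    (hexact : ∀ n : ℤ, P.ExactAt n) :
    (∀ (n : ℤ) (A : ModuleCat.{u} R), IsAbsolutelyPure A →
      Subsingleton (Abelian.Ext.{u} (P.cycles n) A 1)) ∧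
    (∀ n : ℤ, ∃ M : ModuleCat.{u} R,
      IsTransfiniteExtension (finitelyPresentedModules R) M ∧
      Nonempty (Retract (P.cycles n) M)) := by
  have hM := isTransfiniteExtension_ker hR.left P.totalDifferential
    (P.totalDifferential_eq_zero_iff hexact)
  exact ⟨fun n A hA => subsingleton_ext_of_retract (P.cyclesRetractKerTotalDifferential n) A 1
    (hM.subsingleton_ext A hA),
    fun n => ⟨_, hM, ⟨P.cyclesRetractKerTotalDifferential n⟩⟩⟩
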